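/- For a sequence $(\xi_j)_{j\ge 0}$ of real random variables let $p_m(x)=\xi_0+\xi_1x+\dots+\xi_mx^m$, and for an interval $I\subset\mathbb R$ let $N_m(I)$ be the number of real roots of $p_m$ in $I$, counted with multiplicity, with $N_m(I)=\infty$ if $p_m$ is the zero polynomial. Let $\epsilon>0$, $c>1$ and $C>0$. Then there is a constant $c'>0$, depending only on $\epsilon,c,C$, such that the following holds. For all $\epsilon_0>0$ and $M>0$ there is a constant $K>0$, depending only on $\epsilon,c,C,\epsilon_0,M$, such that whenever the $\xi_j$ are independent (not necessarily identically distributed) with $\mathbf E\,\xi_j=0$, $\operatorname{Var}(\xi_j)=1$ and $\mathbf E|\xi_j|^{2+\epsilon_0}\le M$ for all $j\ge 0$, we have for every integer $n\ge 1$ $$\mathbf P\Big(\max_{n\le m\le cn} N_m\big[1-\tfrac{C\log n}{n},\,1\big]>\epsilon\log n\Big)\le K\,n^{-c'},$$ where the maximum is over integers $m$. -/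

import Mathlib

open Polynomial MeasureTheory ProbabilityTheory
open scoped ENNReal

noncomputable section

/-- The polynomial `a 0 + a 1 x + ⋯ + a m x ^ m`. -/
def kacPoly (a : ℕ → ℝ) (m : ℕ) : ℝ[X] :=
  ∑ j ∈ Finset.range (m + 1), C (a j) * X ^ j

open Classical in
/-- The number of roots of `p` in `I`, counted with multiplicity; it is infinite for the zero
polynomial (all sets `I` used here are nonempty). -/
def rootCount (p : ℝ[X]) (I : Set ℝ) : ℕ∞ :=
  if p = 0 then ⊤ else ((p.roots.filter (· ∈ I)).card : ℕ∞)

/-- `max_{n ≤ m ≤ c n} N_m(I)`, where `N_m(I)` is the number of roots in `I` of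
`a 0 + ⋯ + a m x ^ m`. -/
def maxRootCount (a : ℕ → ℝ) (n : ℕ) (c : ℝ) (I : Set ℝ) : ℕ∞ :=
  (Finset.Icc n ⌊c * n⌋₊).sup fun m => rootCount (kacPoly a m) I

end

/-!
The proof bounds the number of roots by a Jensen-type inequality, in the elementary form that each
real root within `r` of `x` halves `|p x|` relative to the maximum of `|p|` on the disc of radius
`3 r` (`abs_eval_mul_two_pow_card_roots_le`). It is applied to a bounded number `L` of intervals of
radius `δ log n / n`, centred at `x_k = 1 - k δ log n / n` for `1 ≤ k ≤ L`, which cover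
`[1 - C log n / n, 1]`.

On these discs the maximum and the value at the centre are both `n ^ (1 / 2)` up to factors
`n ^ (± η)` with `η` much smaller than `ε`, except that the two discs nearest to `1` leave the unit
disc and cost a further factor of at most `n ^ (2 δ c)`, where `δ` is a small multiple of `ε / c`.
So every disc but these two holds `O(η log n)` roots, and those two hold `O((η + δ c) log n)`
(`card_roots_kacPoly_le`).

Two probabilistic inputs suffice.
* All partial sums of the coefficients up to index `c n` are at most `n ^ (1 / 2 + η)`, by
  Kolmogorov's inequality (`measureReal_exists_le_abs_sum_le`). Through summation by parts this
  bounds `p_m` on all the discs for all `m ≤ c n` at once. It also shows that at `x_k`, where the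
  powers beyond `n` are at most `n ^ (-δ)`, the polynomials `p_m` with `n ≤ m ≤ c n` differ from
  `p_n` by less than `n ^ (1 / 2 - η)`; hence no union bound over `m` is needed.
* `|p_n x_k|` is at least `2 n ^ (1 / 2 - η)` outside an event of probability `O(n ^ (-η / 2))`
  (`measureReal_abs_eval_kacPoly_le`). This is an Esseen-type inequality. Since the relevant scale
  `n ^ (1 / 2 - η)` is large, only the characteristic functions of the coefficients near the origin
  matter, and there the moment of order `2 + ε₀` gives `|φ s| ≤ exp (-s² / 4)`. The moment affects
  only the size of that neighbourhood, so the exponent `η / 2` does not depend on `ε₀` or `M`.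
-/

/-! ### A Jensen-type bound for real roots -/

/-- Dividing a polynomial by a linear factor whose root is within `r` of the centre `x` divides
its bound on the disc of radius `3 r` by `2 r`: on the boundary circle the factor is at least
`2 r`, and the maximum modulus principle carries the bound inside. -/
lemma norm_eval_le_of_linear_factor {q : ℂ[X]} {a x : ℂ} {r B : ℝ} (hr : 0 < r)
    (ha : ‖a - x‖ ≤ r)
    (hB : ∀ z : ℂ, ‖z - x‖ ≤ 3 * r → ‖((X - C a) * q).eval z‖ ≤ B) :
    ∀ z : ℂ, ‖z - x‖ ≤ 3 * r → ‖q.eval z‖ ≤ B / (2 * r) := by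
  intro z hz
  have h3 : (3 * r) ≠ 0 := by positivity
  refine Complex.norm_le_of_forall_mem_frontier_norm_le (U := Metric.ball x (3 * r))
    Metric.isBounded_ball q.differentiable.diffContOnCl ?_ ?_
  · intro w hw
    rw [frontier_ball x h3, mem_sphere_iff_norm] at hw
    have h1 := hB w hw.le
    rw [eval_mul, norm_mul] at h1
    have h2 : 2 * r ≤ ‖(X - C a).eval w‖ := by
      simp only [eval_sub, eval_X, eval_C]
      have := norm_sub_norm_le (w - x) (a - x)
      rw [sub_sub_sub_cancel_right] at this
      linarith
    rw [le_div_iff₀ (by positivity), mul_comm]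
    exact (mul_le_mul_of_nonneg_right h2 (norm_nonneg _)).trans h1
  · rw [closure_ball x h3]
    simpa [dist_eq_norm] using hz

/-- Each root within `r` of `x` halves the value at `x`, relative to the bound on the disc of
radius `3 r`. -/
lemma norm_eval_prod_mul_two_pow_le {x : ℂ} {r : ℝ} (hr : 0 < r) (s : Multiset ℂ) :
    ∀ (q : ℂ[X]) (B : ℝ), (∀ a ∈ s, ‖a - x‖ ≤ r) →
      (∀ z : ℂ, ‖z - x‖ ≤ 3 * r → ‖((s.map fun a => X - C a).prod * q).eval z‖ ≤ B) →
      ‖((s.map fun a => X - C a).prod * q).eval x‖ * 2 ^ s.card ≤ B := by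
  induction s using Multiset.induction_on with
  | empty =>
    intro q B _ hB
    simpa using hB x (by simpa using hr.le)
  | cons a s ih =>
    intro q B ha hB
    simp only [Multiset.map_cons, Multiset.prod_cons, mul_assoc] at hB ⊢
    have hax := ha a (Multiset.mem_cons_self a s)
    have h1 := ih q _ (fun b hb => ha b (Multiset.mem_cons_of_mem hb))
      (norm_eval_le_of_linear_factor hr hax hB)
    rw [le_div_iff₀ (by positivity)] at h1
    rw [eval_mul, norm_mul, Multiset.card_cons, pow_succ]
    refine le_trans ?_ h1
    have h2 : ‖(X - C a).eval x‖ ≤ r := by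
      simpa [norm_sub_rev] using hax
    calc _ ≤ r * ‖((s.map fun a => X - C a).prod * q).eval x‖ * (2 ^ s.card * 2) := by gcongr
      _ = _ := by ring

open Classical in
/-- A Jensen-type bound: if `p` is bounded by `B` on the complex disc of radius `3 r` around the
real point `x`, then it has at most `log₂ (B / |p x|)` real roots within `r` of `x`. -/
lemma abs_eval_mul_two_pow_card_roots_le {p : ℝ[X]} {x r B : ℝ} (hr : 0 < r)
    (hB : ∀ z : ℂ, ‖z - x‖ ≤ 3 * r → ‖(p.map (algebraMap ℝ ℂ)).eval z‖ ≤ B) :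
    |p.eval x| * 2 ^ (p.roots.filter (· ∈ Set.Icc (x - r) (x + r))).card ≤ B := by
  by_cases hp : p = 0
  · subst hp
    have := hB x (by simpa using hr.le)
    simpa using this
  set s := p.roots.filter (· ∈ Set.Icc (x - r) (x + r)) with hs
  obtain ⟨q, hq⟩ : (s.map fun a => X - C a).prod ∣ p :=
    (Multiset.prod_X_sub_C_dvd_iff_le_roots hp s).2 (Multiset.filter_le _ _)
  have hmap : p.map (algebraMap ℝ ℂ) =
      ((s.map ((↑) : ℝ → ℂ)).map fun a => X - C a).prod * q.map (algebraMap ℝ ℂ) := by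
    conv_lhs => rw [hq]
    rw [Polynomial.map_mul, Polynomial.map_multiset_prod]
    simp [Multiset.map_map]
  rw [hmap] at hB
  have h := norm_eval_prod_mul_two_pow_le hr (s.map ((↑) : ℝ → ℂ)) _ B (by
    intro a ha
    obtain ⟨b, hb, rfl⟩ := Multiset.mem_map.1 ha
    have hb2 : b ∈ Set.Icc (x - r) (x + r) := (Multiset.mem_filter.1 hb).2
    rw [← Complex.ofReal_sub, Complex.norm_real, Real.norm_eq_abs, abs_le]
    constructor <;> linarith [hb2.1, hb2.2]) hB
  rw [← hmap, Multiset.card_map] at h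
  have he : ‖(p.map (algebraMap ℝ ℂ)).eval (x : ℂ)‖ = |p.eval x| := by
    have : (p.map (algebraMap ℝ ℂ)).eval (x : ℂ) = ((p.eval x : ℝ) : ℂ) := by
      rw [eval_map_algebraMap]
      exact aeval_algebraMap_apply_eq_algebraMap_eval x p
    rw [this, Complex.norm_real, Real.norm_eq_abs]
  rwa [he] at h

/-! ### Kac polynomials and partial sums of their coefficients -/

/-- Summation by parts. -/
lemma sum_range_mul_pow_by_parts {R : Type*} [CommRing R] (a : ℕ → R) (z : R) (m : ℕ) :
    ∑ j ∈ Finset.range (m + 1), a j * z ^ j =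
      (∑ i ∈ Finset.range (m + 1), a i) * z ^ m +
        (1 - z) * ∑ j ∈ Finset.range m, (∑ i ∈ Finset.range (j + 1), a i) * z ^ j := by
  induction m with
  | zero => simp
  | succ m ih =>
    rw [Finset.sum_range_succ, ih, Finset.sum_range_succ a (m + 1),
      Finset.sum_range_succ (fun j => (∑ i ∈ Finset.range (j + 1), a i) * z ^ j) m]
    ring

/-- A polynomial is bounded, up to a factor controlled by the powers of the argument, by the
partial sums of its coefficients. -/
lemma norm_eval_map_kacPoly_le {a : ℕ → ℝ} {m : ℕ} {T A : ℝ} {z : ℂ}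
    (hT : ∀ j ≤ m, |∑ i ∈ Finset.range (j + 1), a i| ≤ T) (hA : ∀ j ≤ m, ‖z‖ ^ j ≤ A) :
    ‖((kacPoly a m).map (algebraMap ℝ ℂ)).eval z‖ ≤ T * A * (1 + ‖1 - z‖ * m) := by
  have hT0 : 0 ≤ T := (abs_nonneg _).trans (hT 0 (Nat.zero_le m))
  have hterm : ∀ j ≤ m, ‖(∑ i ∈ Finset.range (j + 1), (a i : ℂ)) * z ^ j‖ ≤ T * A := by
    intro j hj
    rw [norm_mul, norm_pow, ← Complex.ofReal_sum, Complex.norm_real, Real.norm_eq_abs]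
    exact mul_le_mul (hT j hj) (hA j hj) (by positivity) hT0
  have he : ((kacPoly a m).map (algebraMap ℝ ℂ)).eval z =
      ∑ j ∈ Finset.range (m + 1), (a j : ℂ) * z ^ j := by
    simp [kacPoly, Polynomial.map_sum, eval_finsetSum]
  rw [he, sum_range_mul_pow_by_parts]
  calc _ ≤ ‖(∑ i ∈ Finset.range (m + 1), (a i : ℂ)) * z ^ m‖ +
        ‖1 - z‖ * ∑ j ∈ Finset.range m, ‖(∑ i ∈ Finset.range (j + 1), (a i : ℂ)) * z ^ j‖ := by
        refine (norm_add_le _ _).trans ?_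
        rw [norm_mul (1 - z)]
        gcongr
        exact norm_sum_le _ _
    _ ≤ T * A + ‖1 - z‖ * ∑ j ∈ Finset.range m, T * A := by
        gcongr with j hj
        · exact hterm m le_rfl
        · exact hterm j (Finset.mem_range.1 hj).le
    _ = _ := by simp; ring

/-- For `x ∈ [0, 1]` the terms of degree beyond `n` contribute little once `x ^ n` is small. -/
lemma abs_eval_kacPoly_sub_le {a : ℕ → ℝ} {n m : ℕ} {T x : ℝ} (hnm : n ≤ m) (hx0 : 0 ≤ x)
    (hx1 : x ≤ 1) (hT : ∀ j ≤ m, |∑ i ∈ Finset.range (j + 1), a i| ≤ T) :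
    |(kacPoly a m).eval x - (kacPoly a n).eval x| ≤ 2 * T * x ^ n := by
  have hT0 : 0 ≤ T := (abs_nonneg _).trans (hT 0 (Nat.zero_le m))
  have he : ∀ k, (kacPoly a k).eval x = ∑ j ∈ Finset.range (k + 1), a j * x ^ j := by
    intro k
    simp [kacPoly, eval_finsetSum]
  -- The sharper bound carrying `x ^ n - x ^ m` is the one that passes through the induction.
  have key : ∀ m, n ≤ m → (∀ j ≤ m, |∑ i ∈ Finset.range (j + 1), a i| ≤ T) →
      |(kacPoly a m).eval x - (kacPoly a n).eval x
        - ((∑ i ∈ Finset.range (m + 1), a i) * x ^ m - (∑ i ∈ Finset.range (n + 1), a i) * x ^ n)|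
        ≤ T * (x ^ n - x ^ m) := by
    intro m hm
    induction m, hm using Nat.le_induction with
    | base => intro _; simp
    | succ m hm ih =>
      intro hT
      have h1 := ih fun j hj => hT j (by omega)
      rw [he, Finset.sum_range_succ, ← he, Finset.sum_range_succ a (m + 1)]
      have h2 : |(∑ i ∈ Finset.range (m + 1), a i) * (x ^ m - x ^ (m + 1))|
          ≤ T * (x ^ m - x ^ (m + 1)) := by
        have : 0 ≤ x ^ m - x ^ (m + 1) := sub_nonneg.2 (pow_le_pow_of_le_one hx0 hx1 (by omega))
        rw [abs_mul, abs_of_nonneg this]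
        exact mul_le_mul_of_nonneg_right (hT m (by omega)) this
      rw [abs_le] at h1 h2 ⊢
      constructor <;> nlinarith [h1.1, h1.2, h2.1, h2.2]
  have h1 := key m hnm hT
  have hb : ∀ k ≤ m, |(∑ i ∈ Finset.range (k + 1), a i) * x ^ k| ≤ T * x ^ k := by
    intro k hk
    rw [abs_mul, abs_of_nonneg (pow_nonneg hx0 k)]
    exact mul_le_mul_of_nonneg_right (hT k hk) (pow_nonneg hx0 k)
  have h2 := hb m le_rfl
  have h3 := hb n hnm
  rw [abs_le] at h1 h2 h3 ⊢
  constructor <;> linarith [h1.1, h1.2, h2.1, h2.2, h3.1, h3.2]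

/-! ### Characteristic functions of standardized variables -/

lemma memLp_two_of_variance_eq_one {Ω : Type*} [MeasurableSpace Ω] {μ : Measure Ω}
    [IsProbabilityMeasure μ] {X : Ω → ℝ} (hX : Measurable X) (hv : variance X μ = 1) :
    MemLp X 2 μ := by
  by_contra h
  rw [variance_of_not_memLp hX.aestronglyMeasurable h] at hv
  exact zero_ne_one hv

/-- The second-order Taylor remainder of `exp (i x)`, measured by a power in `(2, 3]`. -/
lemma norm_cexp_sub_taylor_two_le {δ : ℝ} (hδ0 : 0 < δ) (hδ1 : δ ≤ 1) (x : ℝ) :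
    ‖Complex.exp (x * Complex.I) - 1 - x * Complex.I + (x : ℂ) ^ 2 / 2‖ ≤ 4 * |x| ^ (2 + δ) := by
  have hn : ‖(x * Complex.I : ℂ)‖ = |x| := by simp
  rcases le_total |x| 1 with h | h
  · have h1 := Complex.exp_bound (x := x * Complex.I) (by rwa [hn]) (n := 3) (by norm_num)
    rw [hn] at h1
    have h2 : |x| ^ 3 ≤ |x| ^ (2 + δ) := by
      rcases eq_or_ne x 0 with rfl | hx
      · simp; positivity
      rw [← Real.rpow_natCast]
      exact Real.rpow_le_rpow_of_exponent_ge (abs_pos.2 hx) h (by push_cast; linarith)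
    have h3 : ∑ m ∈ Finset.range 3, (x * Complex.I : ℂ) ^ m / (m.factorial : ℂ) =
        1 + x * Complex.I - (x : ℂ) ^ 2 / 2 := by
      simp [Finset.sum_range_succ, Nat.factorial, mul_pow]; ring
    rw [h3] at h1
    have h4 : Complex.exp (x * Complex.I) - 1 - x * Complex.I + (x : ℂ) ^ 2 / 2 =
        Complex.exp (x * Complex.I) - (1 + x * Complex.I - (x : ℂ) ^ 2 / 2) := by ring
    rw [h4]
    refine h1.trans ?_
    have h5 : ((Nat.succ 3 : ℕ) : ℝ) * (((Nat.factorial 3 : ℕ) : ℝ) * (3 : ℕ))⁻¹ ≤ 1 := by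
      norm_num [Nat.factorial]
    have h6 : 0 ≤ |x| ^ 3 := by positivity
    nlinarith
  · have h1 : ‖Complex.exp (x * Complex.I) - 1 - x * Complex.I + (x : ℂ) ^ 2 / 2‖
        ≤ 1 + 1 + |x| + |x| ^ 2 / 2 := by
      refine (norm_add_le _ _).trans (add_le_add ((norm_sub_le _ _).trans
        (add_le_add ((norm_sub_le _ _).trans ?_) hn.le)) ?_)
      · rw [Complex.norm_exp_ofReal_mul_I]; simp
      · simp
    have h2 : |x| ^ 2 ≤ |x| ^ (2 + δ) := by
      rw [← Real.rpow_natCast]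
      exact Real.rpow_le_rpow_of_exponent_le h (by push_cast; linarith)
    nlinarith

/-- Gaussian decay of the characteristic function near the origin, on a neighbourhood depending
only on a bound for a moment of order `2 + ε₀`. -/
lemma exists_norm_charFun_map_le (ε₀ M : ℝ) (hε₀ : 0 < ε₀) :
    ∃ s₀ : ℝ, 0 < s₀ ∧ ∀ (Ω : Type*) [MeasurableSpace Ω] (μ : Measure Ω) [IsProbabilityMeasure μ]
      (X : Ω → ℝ), Measurable X → ∫ ω, X ω ∂μ = 0 → variance X μ = 1 →
      ∫⁻ ω, ENNReal.ofReal (|X ω| ^ (2 + ε₀)) ∂μ ≤ ENNReal.ofReal M →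
      ∀ s : ℝ, |s| ≤ s₀ → ‖charFun (μ.map X) s‖ ≤ Real.exp (-s ^ 2 / 4) := by
  set δ := min ε₀ 1
  have hδ0 : 0 < δ := lt_min hε₀ one_pos
  have hδ1 : δ ≤ 1 := min_le_right _ _
  set M' := 1 + max M 0 with hM'
  have hM1 : 1 ≤ M' := by simp [hM']
  set b : ℝ := 1 / (16 * M') with hb
  have hb0 : 0 < b := by positivity
  have hb1 : b ≤ 1 := by
    rw [hb, div_le_one (by positivity)]; linarith
  refine ⟨b ^ (1 / δ), by positivity, ?_⟩
  intro Ω _ μ _ X hX hmean hvar hmom s hs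
  have hL2 := memLp_two_of_variance_eq_one hX hvar
  have hXi : Integrable X μ := hL2.integrable (by norm_num)
  have hX2 : Integrable (fun ω => X ω ^ 2) μ := hL2.integrable_sq
  have hEX2 : ∫ ω, X ω ^ 2 ∂μ = 1 := by
    rw [← variance_of_integral_eq_zero hX.aemeasurable hmean, hvar]
  have hs1 : |s| ≤ 1 := hs.trans (Real.rpow_le_one hb0.le hb1 (by positivity))
  have hsδ : |s| ^ δ ≤ b := by
    calc |s| ^ δ ≤ (b ^ (1 / δ)) ^ δ := by gcongr
      _ = b := by rw [← Real.rpow_mul hb0.le, one_div_mul_cancel hδ0.ne', Real.rpow_one]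
  have hpm : Measurable fun ω => |X ω| ^ (2 + ε₀) := by fun_prop
  have hpi : Integrable (fun ω => |X ω| ^ (2 + ε₀)) μ := by
    refine ⟨hpm.aestronglyMeasurable, ?_⟩
    rw [hasFiniteIntegral_iff_ofReal (Filter.Eventually.of_forall fun ω => by positivity)]
    exact hmom.trans_lt ENNReal.ofReal_lt_top
  have hpM : ∫ ω, |X ω| ^ (2 + ε₀) ∂μ ≤ max M 0 := by
    rw [integral_eq_lintegral_of_nonneg_ae (Filter.Eventually.of_forall fun ω => by positivity)
      hpm.aestronglyMeasurable]
    refine ENNReal.toReal_le_of_le_ofReal (le_max_right _ _)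
      (hmom.trans (ENNReal.ofReal_le_ofReal (le_max_left _ _)))
  have hei : Integrable (fun ω => Complex.exp (s * X ω * Complex.I)) μ := by
    refine Integrable.of_bound (by fun_prop) 1 (Filter.Eventually.of_forall fun ω => ?_)
    rw [← Complex.ofReal_mul, Complex.norm_exp_ofReal_mul_I]
  have hsX : Integrable (fun ω => (s * X ω * Complex.I : ℂ)) μ :=
    ((hXi.ofReal (𝕜 := ℂ)).const_mul (s : ℂ)).mul_const Complex.I
  have hsX2 : Integrable (fun ω => ((s * X ω : ℂ) ^ 2 / 2)) μ := by
    have := (hX2.ofReal (𝕜 := ℂ)).const_mul ((s : ℂ) ^ 2 / 2)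
    refine this.congr (Filter.Eventually.of_forall fun ω => ?_)
    simp; ring
  have hφ : charFun (μ.map X) s - (1 - (s : ℂ) ^ 2 / 2) =
      ∫ ω, (Complex.exp (s * X ω * Complex.I) - 1 - s * X ω * Complex.I
        + (s * X ω : ℂ) ^ 2 / 2) ∂μ := by
    have e0 : ∫ ω, (Complex.exp (s * X ω * Complex.I) - 1 - s * X ω * Complex.I
        + (s * X ω : ℂ) ^ 2 / 2) ∂μ = ∫ ω, Complex.exp (s * X ω * Complex.I) ∂μ - ∫ _, (1 : ℂ) ∂μ
        - ∫ ω, (s * X ω * Complex.I : ℂ) ∂μ + ∫ ω, ((s * X ω : ℂ) ^ 2 / 2) ∂μ := by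
      have i1 : Integrable (fun _ : Ω => (1 : ℂ)) μ := integrable_const _
      have i2 : Integrable (fun ω => Complex.exp (s * X ω * Complex.I) - 1) μ := hei.sub i1
      have i3 : Integrable
          (fun ω => Complex.exp (s * X ω * Complex.I) - 1 - s * X ω * Complex.I) μ := i2.sub hsX
      rw [integral_add i3 hsX2, integral_sub i2 hsX, integral_sub hei i1]
    have e1 : ∫ ω, (s * X ω * Complex.I : ℂ) ∂μ = 0 := by
      have : ∫ ω, (X ω : ℂ) ∂μ = 0 := by rw [integral_complex_ofReal, hmean]; simp
      rw [integral_mul_const, integral_const_mul, this]; simp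
    have e2 : ∫ ω, ((s * X ω : ℂ) ^ 2 / 2) ∂μ = (s : ℂ) ^ 2 / 2 := by
      have h : ∀ ω, ((s * X ω : ℂ) ^ 2 / 2) = (s : ℂ) ^ 2 / 2 * ((X ω ^ 2 : ℝ) : ℂ) := by
        intro ω; push_cast; ring
      simp_rw [h]
      rw [integral_const_mul, integral_complex_ofReal, hEX2]; simp
    have e3 : charFun (μ.map X) s = ∫ ω, Complex.exp (s * X ω * Complex.I) ∂μ := by
      rw [charFun_apply_real, integral_map hX.aemeasurable]
      exact Measurable.aestronglyMeasurable (by fun_prop)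
    rw [e0, e1, e2, e3]
    simp
    ring
  have hrem : ‖charFun (μ.map X) s - (1 - (s : ℂ) ^ 2 / 2)‖ ≤ s ^ 2 / 4 := by
    rw [hφ]
    have hle : ∀ ω, ‖Complex.exp (s * X ω * Complex.I) - 1 - s * X ω * Complex.I
        + (s * X ω : ℂ) ^ 2 / 2‖ ≤ 4 * |s| ^ (2 + δ) * (1 + |X ω| ^ (2 + ε₀)) := by
      intro ω
      have h1 := norm_cexp_sub_taylor_two_le hδ0 hδ1 (s * X ω)
      push_cast at h1
      refine h1.trans ?_
      rw [abs_mul, Real.mul_rpow (abs_nonneg _) (abs_nonneg _), mul_assoc]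
      gcongr
      rcases le_total |X ω| 1 with h | h
      · have : |X ω| ^ (2 + δ) ≤ 1 := Real.rpow_le_one (abs_nonneg _) h (by positivity)
        have : 0 ≤ |X ω| ^ (2 + ε₀) := by positivity
        linarith
      · have : |X ω| ^ (2 + δ) ≤ |X ω| ^ (2 + ε₀) :=
          Real.rpow_le_rpow_of_exponent_le h (by linarith [min_le_left ε₀ 1])
        linarith
    refine (norm_integral_le_of_norm_le (((integrable_const _).add hpi).const_mul _)
      (Filter.Eventually.of_forall hle)).trans ?_
    rw [integral_const_mul]
    simp only [Pi.add_apply]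
    rw [integral_add (integrable_const _) hpi]
    simp only [integral_const, probReal_univ, smul_eq_mul, mul_one]
    have h1 : |s| ^ (2 + δ) ≤ s ^ 2 * b := by
      rw [Real.rpow_add_of_nonneg (abs_nonneg _) (by norm_num) hδ0.le, Real.rpow_two, sq_abs]
      gcongr
    calc 4 * |s| ^ (2 + δ) * (1 + ∫ ω, |X ω| ^ (2 + ε₀) ∂μ) ≤ 4 * (s ^ 2 * b) * M' := by
          have : 0 ≤ ∫ ω, |X ω| ^ (2 + ε₀) ∂μ := integral_nonneg fun ω => by positivity
          gcongr
          rw [hM']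
          gcongr
      _ = s ^ 2 / 4 := by rw [hb]; field_simp; ring
  have hs2 : s ^ 2 ≤ 1 := by rw [← sq_abs]; exact pow_le_one₀ (abs_nonneg _) hs1
  have hmain : ‖(1 - (s : ℂ) ^ 2 / 2)‖ = 1 - s ^ 2 / 2 := by
    have : (1 - (s : ℂ) ^ 2 / 2) = ((1 - s ^ 2 / 2 : ℝ) : ℂ) := by push_cast; ring
    rw [this, Complex.norm_real, Real.norm_eq_abs, abs_of_nonneg (by linarith)]
  have h1 := norm_add_le (charFun (μ.map X) s - (1 - (s : ℂ) ^ 2 / 2)) (1 - (s : ℂ) ^ 2 / 2)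
  rw [sub_add_cancel, hmain] at h1
  have := Real.add_one_le_exp (-s ^ 2 / 4)
  linarith

/-! ### Small ball estimates -/

lemma integral_exp_neg_mul_sq_gaussianReal_le {b : ℝ} (hb : 0 < b) :
    ∫ x, Real.exp (-b * x ^ 2) ∂(gaussianReal 0 1) ≤ 1 / Real.sqrt (2 * b) := by
  rw [integral_gaussianReal_eq_integral_smul one_ne_zero]
  have h1 : ∀ x, gaussianPDFReal 0 1 x • Real.exp (-b * x ^ 2) ≤
      (Real.sqrt (2 * Real.pi))⁻¹ * Real.exp (-b * x ^ 2) := by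
    intro x
    rw [smul_eq_mul, gaussianPDFReal]
    gcongr
    have : Real.exp (-(x - 0) ^ 2 / (2 * ((1 : NNReal) : ℝ))) ≤ 1 := by
      rw [Real.exp_le_one_iff]
      have : 0 ≤ (x - 0) ^ 2 / (2 * ((1 : NNReal) : ℝ)) := by positivity
      rw [neg_div]; linarith
    have h0 : 0 ≤ (Real.sqrt (2 * Real.pi))⁻¹ := by positivity
    simpa using mul_le_mul_of_nonneg_left this h0
  refine (integral_mono_of_nonneg (Filter.Eventually.of_forall fun x => ?_)
    ((integrable_exp_neg_mul_sq hb).const_mul _) (Filter.Eventually.of_forall h1)).trans ?_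
  · exact smul_nonneg (gaussianPDFReal_nonneg _ _ _) (Real.exp_pos _).le
  rw [integral_const_mul, integral_gaussian]
  refine le_of_eq ?_
  rw [← Real.sqrt_inv, ← Real.sqrt_mul (by positivity), one_div, ← Real.sqrt_inv]
  congr 1
  field_simp

/-- Esseen's small ball inequality with a Gaussian weight: up to a constant the left side is at
most `E exp (-S² / (2 r²))`, which is the mean of the characteristic function of `S` at `G / r` for a
standard Gaussian `G`. -/
lemma measureReal_abs_le_of_norm_charFun_le {Ω : Type*} [MeasurableSpace Ω] {μ : Measure Ω}
    [IsProbabilityMeasure μ] {S : Ω → ℝ} (hS : Measurable S) {a r s₀ : ℝ} (ha : 0 < a)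
    (hr : 0 < r) (hs₀ : 0 < s₀)
    (h : ∀ t : ℝ, |t| ≤ s₀ → ‖charFun (μ.map S) t‖ ≤ Real.exp (-a * t ^ 2)) :
    μ.real {ω | |S ω| ≤ r} ≤ 2 * (r / Real.sqrt (2 * a) + 1 / (r * s₀) ^ 2) := by
  have : IsProbabilityMeasure (μ.map S) := Measure.isProbabilityMeasure_map hS.aemeasurable
  set γ := gaussianReal 0 1
  -- Fubini for the kernel `exp (i x y / r)`.
  have hswap : ∫ y, Complex.exp (-(y / r : ℂ) ^ 2 / 2) ∂(μ.map S) =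
      ∫ x, charFun (μ.map S) (x / r) ∂γ := by
    have h1 : ∀ y : ℝ, Complex.exp (-(y / r : ℂ) ^ 2 / 2) =
        ∫ x : ℝ, Complex.exp (x * y / r * Complex.I) ∂γ := by
      intro y
      have h2 := charFun_gaussianReal (μ := 0) (v := 1) (y / r)
      rw [charFun_apply_real] at h2
      have h3 : ∀ x : ℝ, (x * y / r * Complex.I : ℂ) = ((y / r : ℝ) : ℂ) * x * Complex.I := by
        intro x; push_cast; ring
      simp_rw [h3]
      rw [h2]
      congr 1
      push_cast; ring
    simp_rw [h1]
    rw [integral_integral_swap]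
    · refine integral_congr_ae (Filter.Eventually.of_forall fun x => ?_)
      simp only [charFun_apply_real]
      refine integral_congr_ae (Filter.Eventually.of_forall fun y => ?_)
      simp only
      congr 1
      push_cast; ring
    · refine Integrable.of_bound (Measurable.aestronglyMeasurable
        (by unfold Function.uncurry; fun_prop)) 1 (Filter.Eventually.of_forall fun p => ?_)
      have : ((p.2 : ℂ) * p.1 / r * Complex.I) = ((p.2 * p.1 / r : ℝ) : ℂ) * Complex.I := by
        push_cast; ring
      simp only [Function.uncurry, this, Complex.norm_exp_ofReal_mul_I, le_refl]
  have hreal : ∫ y, Complex.exp (-(y / r : ℂ) ^ 2 / 2) ∂(μ.map S) =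
      ((∫ y, Real.exp (-(y / r) ^ 2 / 2) ∂(μ.map S) : ℝ) : ℂ) := by
    rw [← integral_complex_ofReal]
    refine integral_congr_ae (Filter.Eventually.of_forall fun x => ?_)
    push_cast; rfl
  have hxsq : Integrable (fun x : ℝ => x ^ 2) γ :=
    (memLp_id_gaussianReal' (μ := 0) (v := 1) 2 (by norm_num)).integrable_sq
  have hxsq1 : ∫ x : ℝ, x ^ 2 ∂γ = 1 := by
    have h1 := variance_id_gaussianReal (μ := 0) (v := 1)
    rw [variance_of_integral_eq_zero aemeasurable_id (by simp [integral_id_gaussianReal])] at h1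
    simpa using h1
  have hexpi : Integrable (fun x : ℝ => Real.exp (-(a / r ^ 2) * x ^ 2)) γ := by
    refine Integrable.of_bound (by fun_prop) 1 (Filter.Eventually.of_forall fun x => ?_)
    rw [Real.norm_eq_abs, abs_of_pos (Real.exp_pos _), Real.exp_le_one_iff]
    have : 0 ≤ a / r ^ 2 * x ^ 2 := by positivity
    linarith
  -- Beyond `r s₀` the trivial bound `1` on the characteristic function is absorbed by `x²`.
  have hpt : ∀ x : ℝ, ‖charFun (μ.map S) (x / r)‖ ≤
      Real.exp (-(a / r ^ 2) * x ^ 2) + x ^ 2 / (r * s₀) ^ 2 := by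
    intro x
    rcases le_total |x / r| s₀ with hx | hx
    · have h1 := h _ hx
      have h2 : -a * (x / r) ^ 2 = -(a / r ^ 2) * x ^ 2 := by field_simp
      rw [h2] at h1
      have : 0 ≤ x ^ 2 / (r * s₀) ^ 2 := by positivity
      linarith
    · have h1 := norm_charFun_le_one (μ := μ.map S) (x / r)
      have h2 : 1 ≤ x ^ 2 / (r * s₀) ^ 2 := by
        rw [one_le_div (by positivity), ← sq_abs x]
        rw [abs_div, abs_of_pos hr, le_div_iff₀ hr] at hx
        gcongr
        linarith
      have := (Real.exp_pos (-(a / r ^ 2) * x ^ 2)).le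
      linarith
  have hmain : ∫ y, Real.exp (-(y / r) ^ 2 / 2) ∂(μ.map S) ≤
      r / Real.sqrt (2 * a) + 1 / (r * s₀) ^ 2 := by
    have h1 : ‖∫ x, charFun (μ.map S) (x / r) ∂γ‖ ≤
        r / Real.sqrt (2 * a) + 1 / (r * s₀) ^ 2 := by
      refine (norm_integral_le_of_norm_le (hexpi.add (hxsq.div_const _))
        (Filter.Eventually.of_forall hpt)).trans ?_
      simp only [Pi.add_apply]
      rw [integral_add hexpi (hxsq.div_const _), integral_div, hxsq1]
      gcongr
      refine (integral_exp_neg_mul_sq_gaussianReal_le (by positivity)).trans (le_of_eq ?_)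
      rw [mul_div_assoc', Real.sqrt_div (by positivity), Real.sqrt_sq hr.le, one_div_div]
    rw [← hswap, hreal, Complex.norm_real, Real.norm_eq_abs] at h1
    exact (le_abs_self _).trans h1
  rw [integral_map hS.aemeasurable (Measurable.aestronglyMeasurable (by fun_prop))] at hmain
  have hmarkov : 1 / 2 * μ.real {ω | |S ω| ≤ r} ≤ ∫ ω, Real.exp (-(S ω / r) ^ 2 / 2) ∂μ := by
    have hint : Integrable (fun ω => Real.exp (-(S ω / r) ^ 2 / 2)) μ := by
      refine Integrable.of_bound (Measurable.aestronglyMeasurable (by fun_prop)) 1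
        (Filter.Eventually.of_forall fun x => ?_)
      rw [Real.norm_eq_abs, abs_of_pos (Real.exp_pos _), Real.exp_le_one_iff, neg_div]
      have : 0 ≤ (S x / r) ^ 2 / 2 := by positivity
      linarith
    refine le_trans ?_ (mul_meas_ge_le_integral_of_nonneg
      (Filter.Eventually.of_forall fun ω => (Real.exp_pos _).le) hint (1 / 2))
    refine mul_le_mul_of_nonneg_left (measureReal_mono fun ω hω => ?_) (by norm_num)
    simp only [Set.mem_ofPred_eq] at hω ⊢
    have h1 : (S ω / r) ^ 2 ≤ 1 := by
      rw [← sq_abs, abs_div, abs_of_pos hr]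
      exact pow_le_one₀ (by positivity) ((div_le_one hr).2 hω)
    have := Real.add_one_le_exp (-(S ω / r) ^ 2 / 2)
    linarith
  linarith

/-- Small ball estimate for a weighted sum, relative to its variance. -/
lemma measureReal_abs_sum_le {Ω : Type*} [MeasurableSpace Ω] {μ : Measure Ω}
    [IsProbabilityMeasure μ] {ξ : ℕ → Ω → ℝ} (hξ : ∀ j, Measurable (ξ j)) (hind : iIndepFun ξ μ)
    {s₀ : ℝ} (hs₀ : 0 < s₀)
    (h : ∀ j s, |s| ≤ s₀ → ‖charFun (μ.map (ξ j)) s‖ ≤ Real.exp (-s ^ 2 / 4))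
    {w : ℕ → ℝ} (hw : ∀ j, |w j| ≤ 1) {N : ℕ} {σ r : ℝ} (hσ : 0 < σ)
    (hσw : σ ≤ ∑ j ∈ Finset.range N, w j ^ 2) (hr : 0 < r) :
    μ.real {ω | |∑ j ∈ Finset.range N, w j * ξ j ω| ≤ r} ≤
      2 * (r / Real.sqrt (σ / 2) + 1 / (r * s₀) ^ 2) := by
  have hm : ∀ j, Measurable fun ω => w j * ξ j ω := fun j => (hξ j).const_mul _
  have hind' : iIndepFun (fun j ω => w j * ξ j ω) μ :=
    hind.comp (fun j x => w j * x) fun j => measurable_const_mul _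
  have h2 : σ / 2 = 2 * (σ / 4) := by ring
  rw [h2]
  refine measureReal_abs_le_of_norm_charFun_le (Finset.measurable_fun_sum _ fun j _ => hm j)
    (by positivity) hr hs₀ fun t ht => ?_
  rw [iIndepFun.charFun_map_fun_finsetSum_eq_prod (fun j _ => (hm j).aemeasurable)
    (hind'.restrict _), Finset.prod_apply, norm_prod]
  calc ∏ j ∈ Finset.range N, ‖charFun (μ.map fun ω => w j * ξ j ω) t‖
      ≤ ∏ j ∈ Finset.range N, Real.exp (-(w j * t) ^ 2 / 4) := by
        gcongr with j _
        rw [charFun_map_mul_comp (hξ j).aemeasurable]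
        refine h j _ ?_
        rw [abs_mul]
        nlinarith [hw j, abs_nonneg t, abs_nonneg (w j)]
    _ = Real.exp (-((∑ j ∈ Finset.range N, w j ^ 2) / 4) * t ^ 2) := by
        rw [← Real.exp_sum]
        congr 1
        rw [Finset.sum_div, ← Finset.sum_neg_distrib, Finset.sum_mul]
        exact Finset.sum_congr rfl fun j _ => by ring
    _ ≤ _ := by
        rw [Real.exp_le_exp]
        nlinarith [sq_nonneg t]

/-! ### Kolmogorov's maximal inequality -/

/-- Kolmogorov's maximal inequality for variables of unit variance. -/
lemma measureReal_exists_le_abs_sum_le {Ω : Type*} [MeasurableSpace Ω] {μ : Measure Ω}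
    [IsProbabilityMeasure μ] {ξ : ℕ → Ω → ℝ} (hξ : ∀ j, Measurable (ξ j)) (hind : iIndepFun ξ μ)
    (hmean : ∀ j, ∫ ω, ξ j ω ∂μ = 0) (hvar : ∀ j, variance (ξ j) μ = 1) (N : ℕ) {t : ℝ}
    (ht : 0 < t) :
    μ.real {ω | ∃ j ≤ N, t ≤ |∑ i ∈ Finset.range (j + 1), ξ i ω|} ≤ (N + 1) / t ^ 2 := by
  have hL2 : ∀ j, MemLp (ξ j) 2 μ := fun j => memLp_two_of_variance_eq_one (hξ j) (hvar j)
  have hint : ∀ j, Integrable (ξ j) μ := fun j => (hL2 j).integrable (by norm_num)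
  set S : ℕ → Ω → ℝ := fun j ω => ∑ i ∈ Finset.range (j + 1), ξ i ω with hS
  have hSL2 : ∀ j, MemLp (S j) 2 μ := fun j => memLp_finsetSum _ fun i _ => hL2 i
  let ℱ := Filtration.natural ξ fun j => (hξ j).stronglyMeasurable
  have hSm : ∀ j, Measurable[ℱ j] (S j) := by
    intro j
    refine Finset.measurable_fun_sum _ fun i hi => ?_
    have h1 : Measurable[ℱ i] (ξ i) :=
      (Filtration.stronglyAdapted_natural (u := ξ) fun j => (hξ j).stronglyMeasurable) i
        |>.measurable
    exact h1.mono (ℱ.mono (Nat.lt_succ_iff.1 (Finset.mem_range.1 hi))) le_rfl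
  have hsub : Submartingale (fun j ω => S j ω ^ 2) ℱ μ := by
    refine submartingale_of_setIntegral_le_succ
      (fun j => ((hSm j).pow_const 2).stronglyMeasurable) (fun j => (hSL2 j).integrable_sq) ?_
    intro j A hA
    have hA' : MeasurableSet A := ℱ.le j A hA
    have hSA : Measurable[ℱ j] (A.indicator (S j)) := (hSm j).indicator hA
    have hindep : IndepFun (A.indicator (S j)) (ξ (j + 1)) μ := by
      rw [IndepFun_iff_Indep]
      have h1 := hind.indep_comap_natural_of_lt (fun j => (hξ j).stronglyMeasurable)
        (Nat.lt_succ_self j)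
      exact indep_of_indep_of_le_left h1.symm hSA.comap_le
    have hcross : ∫ ω in A, S j ω * ξ (j + 1) ω ∂μ = 0 := by
      rw [← integral_indicator hA']
      have h1 : A.indicator (fun ω => S j ω * ξ (j + 1) ω) =
          fun ω => A.indicator (S j) ω * ξ (j + 1) ω := by
        funext ω
        by_cases hω : ω ∈ A <;> simp [hω]
      rw [h1, hindep.integral_fun_mul_eq_mul_integral
        (hSA.mono (ℱ.le j) le_rfl).aestronglyMeasurable (hξ _).aestronglyMeasurable, hmean,
        mul_zero]
    have hprod : Integrable (fun ω => S j ω * ξ (j + 1) ω) μ := (hSL2 j).integrable_mul (hL2 _)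
    have h2 : ∫ ω in A, S j ω ^ 2 ∂μ = ∫ ω in A, (S j ω ^ 2 + 2 * (S j ω * ξ (j + 1) ω)) ∂μ := by
      rw [integral_add (hSL2 j).integrable_sq.integrableOn (hprod.const_mul 2).integrableOn,
        integral_const_mul, hcross]
      simp
    rw [h2]
    refine setIntegral_mono ((hSL2 j).integrable_sq.integrableOn.add
      (hprod.const_mul 2).integrableOn) (hSL2 _).integrable_sq.integrableOn fun ω => ?_
    have h3 : S (j + 1) ω = S j ω + ξ (j + 1) ω := Finset.sum_range_succ _ _
    simp only [h3]
    nlinarith [sq_nonneg (ξ (j + 1) ω)]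
  have hES : ∫ ω, S N ω ^ 2 ∂μ = N + 1 := by
    have h0 : ∫ ω, S N ω ∂μ = 0 := by
      simp only [hS]
      rw [integral_finsetSum _ fun i _ => hint i]
      simp [hmean]
    rw [← variance_of_integral_eq_zero (hSL2 N).aemeasurable h0]
    have h1 : S N = ∑ i ∈ Finset.range (N + 1), ξ i := by
      funext ω; simp [hS]
    rw [h1, IndepFun.variance_sum (fun i _ => hL2 i) fun i _ j _ hij => hind.indepFun hij]
    simp [hvar]
  have hmax := maximal_ineq hsub (fun j ω => sq_nonneg _) (ε := (t ^ 2).toNNReal) N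
  have hset : {ω | ∃ j ≤ N, t ≤ |∑ i ∈ Finset.range (j + 1), ξ i ω|} ⊆
      {ω | (((t ^ 2).toNNReal : NNReal) : ℝ) ≤ (Finset.range (N + 1)).sup'
        Finset.nonempty_range_add_one fun k => S k ω ^ 2} := by
    rintro ω ⟨j, hj, hjt⟩
    simp only [Set.mem_ofPred_eq, Real.coe_toNNReal _ (sq_nonneg t)]
    refine le_trans ?_ (Finset.le_sup' (fun k => S k ω ^ 2)
      (Finset.mem_range.2 (Nat.lt_succ_of_le hj)))
    rw [← sq_abs (S j ω)]
    gcongr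
  rw [le_div_iff₀ (by positivity), mul_comm]
  have hfin : ENNReal.ofReal (t ^ 2 * μ.real {ω | ∃ j ≤ N, t ≤ |∑ i ∈ Finset.range (j + 1), ξ i ω|})
      ≤ ENNReal.ofReal (N + 1) := by
    rw [ENNReal.ofReal_mul (sq_nonneg t), ofReal_measureReal]
    calc _ ≤ _ := mul_le_mul_right (measure_mono hset) _
      _ ≤ _ := hmax
      _ ≤ _ := by
        refine ENNReal.ofReal_le_ofReal ?_
        rw [← hES]
        exact setIntegral_le_integral (hSL2 N).integrable_sq
          (Filter.Eventually.of_forall fun ω => sq_nonneg _)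
  exact (ENNReal.ofReal_le_ofReal_iff (by positivity)).1 hfin

/-! ### Counting the roots near 1 on a good event -/

lemma card_filter_le_sum_card_filter {α ι : Type*} (s : Multiset α) (F : Finset ι) (P : α → Prop)
    (Q : ι → α → Prop) [DecidablePred P] [∀ k, DecidablePred (Q k)]
    (h : ∀ a, P a → ∃ k ∈ F, Q k a) :
    (s.filter P).card ≤ ∑ k ∈ F, (s.filter (Q k)).card := by
  induction s using Multiset.induction_on with
  | empty => simp
  | cons a s ih =>
    simp only [Multiset.filter_cons, Multiset.card_add, Finset.sum_add_distrib]
    refine add_le_add ?_ ih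
    by_cases ha : P a
    · obtain ⟨k, hk, hka⟩ := h a ha
      refine le_trans ?_ (Finset.single_le_sum (fun i _ => Nat.zero_le _) hk)
      simp [ha, hka]
    · simp [ha]

/-- The number of roots of `kacPoly a m` in one interval of length `2 δ log n / n`, when the partial
sums of the coefficients and the value at the centre are both `n ^ (1 / 2)` up to factors
`n ^ (± η)`. Only for `k ≤ 2` does the disc used by the Jensen-type bound leave the unit disc; the
powers of its points then grow to at most
`n ^ (2 δ c)`. -/
lemma card_roots_near_le {a : ℕ → ℝ} {n m k : ℕ} {c δ η : ℝ} (hn : 2 ≤ n) (hm : (m : ℝ) ≤ c * n)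
    (hδ : 0 < δ) (hk : 1 ≤ k) (hk1 : k * δ * (Real.log n / n) ≤ 1)
    (hη : 1 + (k + 3) * δ * c * Real.log n ≤ Real.exp (η * Real.log n))
    (hT : ∀ j ≤ m, |∑ i ∈ Finset.range (j + 1), a i| ≤ Real.exp ((1 / 2 + η) * Real.log n))
    (hx : Real.exp ((1 / 2 - η) * Real.log n) ≤
      |(kacPoly a m).eval (1 - k * δ * (Real.log n / n))|) :
    (((kacPoly a m).roots.filter (· ∈ Set.Icc
      (1 - k * δ * (Real.log n / n) - δ * (Real.log n / n))
      (1 - k * δ * (Real.log n / n) + δ * (Real.log n / n)))).card : ℝ) ≤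
      (6 * η + if k ≤ 2 then 4 * δ * c else 0) * Real.log n := by
  have hn0 : (0 : ℝ) < n := by positivity
  have hl : 0 < Real.log n := Real.log_pos (by exact_mod_cast hn)
  set l := Real.log n
  set ρ := l / n with hρ
  have hρ0 : 0 < ρ := by positivity
  have hρm : ρ * m ≤ c * l := by
    calc ρ * m ≤ ρ * (c * n) := by gcongr
      _ = c * l := by rw [hρ]; field_simp
  have hc0 : 0 ≤ c := by
    by_contra hc
    have : c * n < 0 := mul_neg_of_neg_of_pos (not_le.1 hc) hn0
    have : (0 : ℝ) ≤ m := Nat.cast_nonneg m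
    linarith
  have hk1' : (1 : ℝ) ≤ k := by exact_mod_cast hk
  set x := 1 - k * δ * ρ with hxdef
  set g : ℝ := if k ≤ 2 then 2 * δ else 0 with hg
  have hg0 : 0 ≤ g := by rw [hg]; split_ifs <;> positivity
  have hB : ∀ z : ℂ, ‖z - x‖ ≤ 3 * (δ * ρ) → ‖((kacPoly a m).map (algebraMap ℝ ℂ)).eval z‖ ≤
      Real.exp ((1 / 2 + η) * l) * Real.exp (g * c * l) * Real.exp (η * l) := by
    intro z hz
    have hxn : ‖(x : ℂ)‖ = x := by
      rw [Complex.norm_real, Real.norm_eq_abs, abs_of_nonneg (by linarith)]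
    have hzn : ‖z‖ ≤ 1 + g * ρ := by
      have h1 := norm_add_le (z - x) (x : ℂ)
      rw [sub_add_cancel, hxn] at h1
      have h2 : 3 * (δ * ρ) + x ≤ 1 + g * ρ := by
        rw [hxdef, hg]
        have hδρ : 0 < δ * ρ := by positivity
        split_ifs with h
        · nlinarith
        · have : (3 : ℝ) ≤ k := by exact_mod_cast (by omega : 3 ≤ k)
          nlinarith
      linarith
    have hA : ∀ j ≤ m, ‖z‖ ^ j ≤ Real.exp (g * c * l) := by
      intro j hj
      calc ‖z‖ ^ j ≤ (Real.exp (g * ρ)) ^ j := by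
            gcongr
            linarith [Real.add_one_le_exp (g * ρ)]
        _ = Real.exp (j * (g * ρ)) := by rw [Real.exp_nat_mul]
        _ ≤ Real.exp (g * c * l) := by
            rw [Real.exp_le_exp]
            calc j * (g * ρ) ≤ m * (g * ρ) := by gcongr
              _ = g * (ρ * m) := by ring
              _ ≤ g * (c * l) := by gcongr
              _ = _ := by ring
    refine (norm_eval_map_kacPoly_le hT hA).trans ?_
    gcongr
    have h1z : ‖1 - z‖ ≤ (k + 3) * δ * ρ := by
      have h1 : (1 - z : ℂ) = ((k * δ * ρ : ℝ) : ℂ) - (z - x) := by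
        rw [hxdef]; push_cast; ring
      rw [h1]
      refine (norm_sub_le _ _).trans ?_
      rw [Complex.norm_real, Real.norm_eq_abs, abs_of_nonneg (by positivity)]
      linarith
    calc 1 + ‖1 - z‖ * m ≤ 1 + (k + 3) * δ * ρ * m := by gcongr
      _ = 1 + (k + 3) * δ * (ρ * m) := by ring
      _ ≤ 1 + (k + 3) * δ * (c * l) := by gcongr
      _ = 1 + (k + 3) * δ * c * l := by ring
      _ ≤ _ := hη
  have hJ := abs_eval_mul_two_pow_card_roots_le (by positivity : 0 < δ * ρ) hB
  set N := ((kacPoly a m).roots.filter (· ∈ Set.Icc (x - δ * ρ) (x + δ * ρ))).card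
  have h1 : Real.exp ((1 / 2 - η) * l) * Real.exp (N * Real.log 2) ≤
      Real.exp ((1 / 2 + η) * l) * Real.exp (g * c * l) * Real.exp (η * l) := by
    refine le_trans ?_ hJ
    rw [Real.exp_nat_mul, Real.exp_log two_pos]
    gcongr
  rw [← Real.exp_add, ← Real.exp_add, ← Real.exp_add, Real.exp_le_exp] at h1
  have h2 : (N : ℝ) * (1 / 2) ≤ N * Real.log 2 := by
    gcongr
    linarith [Real.log_two_gt_d9]
  have h3 : (if k ≤ 2 then 4 * δ * c else 0) = 2 * (g * c) := by
    rw [hg]; split_ifs <;> ring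
  rw [h3]
  linarith

/-- The deterministic part: if the partial sums of the coefficients are at most `n ^ (1 / 2 + η)`
and the polynomial of degree `n` is at least `2 n ^ (1 / 2 - η)` at the points
`1 - k δ log n / n`, `1 ≤ k ≤ L`, then all polynomials of degree `m ∈ [n, c n]` have few roots in
`[1 - C log n / n, 1]`. -/
lemma card_roots_kacPoly_le {a : ℕ → ℝ} {n m L : ℕ} {C c δ η : ℝ} (hn : 2 ≤ n) (hnm : n ≤ m)
    (hm : (m : ℝ) ≤ c * n) (hC : 0 < C) (hδ : 0 < δ) (hL : C / δ + 1 ≤ L)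
    (hL1 : L * δ * (Real.log n / n) ≤ 1)
    (hη : 1 + (L + 3) * δ * c * Real.log n ≤ Real.exp (η * Real.log n))
    (h2 : 2 ≤ Real.exp ((δ - 2 * η) * Real.log n))
    (hT : ∀ j ≤ m, |∑ i ∈ Finset.range (j + 1), a i| ≤ Real.exp ((1 / 2 + η) * Real.log n))
    (hx : ∀ k ∈ Finset.Icc 1 L, 2 * Real.exp ((1 / 2 - η) * Real.log n) ≤
      |(kacPoly a n).eval (1 - k * δ * (Real.log n / n))|) :
    kacPoly a m ≠ 0 ∧
      (((kacPoly a m).roots.filter (· ∈ Set.Icc (1 - C * Real.log n / n) 1)).card : ℝ) ≤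
        (6 * η * L + 8 * δ * c) * Real.log n := by
  have hn0 : (0 : ℝ) < n := by positivity
  have hl : 0 < Real.log n := Real.log_pos (by exact_mod_cast hn)
  set l := Real.log n
  have hρ0 : 0 < l / n := by positivity
  have hc0 : 0 ≤ c := by
    by_contra hc
    have : c * n < 0 := mul_neg_of_neg_of_pos (not_le.1 hc) hn0
    have : (0 : ℝ) ≤ m := Nat.cast_nonneg m
    linarith
  have hkL : ∀ k ∈ Finset.Icc 1 L, (1 : ℝ) ≤ k ∧ (k : ℝ) ≤ L := fun k hk =>
    ⟨by exact_mod_cast (Finset.mem_Icc.1 hk).1, by exact_mod_cast (Finset.mem_Icc.1 hk).2⟩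
  have hk1 : ∀ k ∈ Finset.Icc 1 L, k * δ * (l / n) ≤ 1 := by
    intro k hk
    refine le_trans ?_ hL1
    have := (hkL k hk).2
    gcongr
  have hpx : ∀ k ∈ Finset.Icc 1 L, Real.exp ((1 / 2 - η) * l) ≤
      |(kacPoly a m).eval (1 - k * δ * (l / n))| := by
    intro k hk
    have hu0 : 0 ≤ k * δ * (l / n) := by positivity
    have hd := abs_eval_kacPoly_sub_le hnm (sub_nonneg.2 (hk1 k hk)) (by linarith) hT
    -- The terms beyond degree `n` carry the factor `x ^ n ≤ n ^ (-δ)`.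
    have hpow : (1 - k * δ * (l / n)) ^ n ≤ Real.exp (-(δ * l)) := by
      calc (1 - k * δ * (l / n)) ^ n ≤ (Real.exp (-(k * δ * (l / n)))) ^ n := by
            refine pow_le_pow_left₀ (sub_nonneg.2 (hk1 k hk)) ?_ n
            linarith [Real.add_one_le_exp (-(k * δ * (l / n)))]
        _ = Real.exp (-(k * (δ * l))) := by
            rw [← Real.exp_nat_mul]; congr 1; field_simp
        _ ≤ _ := by
            rw [Real.exp_le_exp]
            have := (hkL k hk).1
            have : 0 < δ * l := by positivity
            nlinarith
    have htail : 2 * Real.exp ((1 / 2 + η) * l) * (1 - k * δ * (l / n)) ^ n ≤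
        Real.exp ((1 / 2 - η) * l) := by
      have hx0 := pow_nonneg (sub_nonneg.2 (hk1 k hk)) n
      calc _ ≤ Real.exp ((δ - 2 * η) * l) * Real.exp ((1 / 2 + η) * l) * Real.exp (-(δ * l)) := by
            gcongr
        _ = _ := by rw [← Real.exp_add, ← Real.exp_add]; congr 1; ring
    have h3 := hx k hk
    have h4 := abs_sub_abs_le_abs_sub ((kacPoly a n).eval (1 - k * δ * (l / n)))
      ((kacPoly a m).eval (1 - k * δ * (l / n)))
    rw [abs_sub_comm] at h4
    linarith
  refine ⟨?_, ?_⟩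
  · intro h0
    have hL0 : 1 ≤ L := by
      have h1 : (0 : ℝ) < L := lt_of_lt_of_le (by positivity) hL
      exact_mod_cast h1
    have h1 := hpx 1 (Finset.mem_Icc.2 ⟨le_rfl, hL0⟩)
    rw [h0] at h1
    simp only [eval_zero, abs_zero] at h1
    exact absurd (Real.exp_pos _) (not_lt.2 h1)
  · have hcover : ∀ y, y ∈ Set.Icc (1 - C * l / n) 1 → ∃ k ∈ Finset.Icc 1 L, y ∈ Set.Icc
        (1 - k * δ * (l / n) - δ * (l / n)) (1 - k * δ * (l / n) + δ * (l / n)) := by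
      rintro y ⟨hy1, hy2⟩
      set u := (1 - y) / (δ * (l / n)) with hu
      have hu0 : 0 ≤ u := div_nonneg (by linarith) (by positivity)
      have huy : u * (δ * (l / n)) = 1 - y := div_mul_cancel₀ _ (by positivity)
      have huC : u ≤ C / δ := by
        rw [hu, div_le_div_iff₀ (by positivity) hδ]
        have h1 : C * (δ * (l / n)) = (C * l / n) * δ := by ring
        rw [h1]
        gcongr
        linarith
      have hf1 := Nat.floor_le hu0
      have hf2 := Nat.lt_floor_add_one u
      refine ⟨⌊u⌋₊ + 1, Finset.mem_Icc.2 ⟨by omega, ?_⟩, ?_⟩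
      · have : ((⌊u⌋₊ + 1 : ℕ) : ℝ) ≤ L := by push_cast; linarith
        exact_mod_cast this
      · have hp : 0 < δ * (l / n) := by positivity
        push_cast
        constructor <;> nlinarith
    have hcard := card_filter_le_sum_card_filter (kacPoly a m).roots (Finset.Icc 1 L)
      (· ∈ Set.Icc (1 - C * l / n) 1) _ hcover
    have hsum : (((kacPoly a m).roots.filter (· ∈ Set.Icc (1 - C * l / n) 1)).card : ℝ) ≤
        ∑ k ∈ Finset.Icc 1 L, (6 * η + if k ≤ 2 then 4 * δ * c else 0) * l := by
      refine (Nat.cast_le.2 hcard).trans ?_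
      rw [Nat.cast_sum]
      refine Finset.sum_le_sum fun k hk => ?_
      refine card_roots_near_le hn hm hδ (Finset.mem_Icc.1 hk).1 (hk1 k hk) ?_ hT (hpx k hk)
      refine le_trans ?_ hη
      have := (hkL k hk).2
      gcongr
    refine hsum.trans ?_
    rw [← Finset.sum_mul]
    refine mul_le_mul_of_nonneg_right ?_ hl.le
    rw [Finset.sum_add_distrib, ← Finset.sum_filter, Finset.sum_const, Finset.sum_const,
      Nat.card_Icc, nsmul_eq_mul, nsmul_eq_mul]
    have hcard2 : (((Finset.Icc 1 L).filter (· ≤ 2)).card : ℝ) ≤ 2 := by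
      have h1 : (Finset.Icc 1 L).filter (· ≤ 2) ⊆ Finset.Icc 1 2 := by
        intro k hk
        rw [Finset.mem_filter, Finset.mem_Icc] at hk
        exact Finset.mem_Icc.2 ⟨hk.1.1, hk.2⟩
      have := Finset.card_le_card h1
      rw [Nat.card_Icc] at this
      exact_mod_cast this
    have : 0 ≤ 4 * δ * c := by positivity
    simp only [Nat.add_sub_cancel]
    nlinarith

/-! ### Probability of the good event -/

/-- The sum of the squares of the weights `(1 - u) ^ j`, bounded below by the terms with
`j ≤ 1 / (4 u)`, each of which is at least `1 / 2`. -/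
lemma one_div_le_sum_range_sq_pow {u : ℝ} {N : ℕ} (hu0 : 0 < u) (hu1 : u ≤ 1)
    (hN : 1 / (4 * u) ≤ N) :
    1 / (8 * u) ≤ ∑ j ∈ Finset.range (N + 1), ((1 - u) ^ j) ^ 2 := by
  set J := ⌊1 / (4 * u)⌋₊
  have hJu : (J : ℝ) ≤ 1 / (4 * u) := Nat.floor_le (by positivity)
  have hJN : J ≤ N := by exact_mod_cast hJu.trans hN
  have hJ1 : 1 / (4 * u) < J + 1 := Nat.lt_floor_add_one _
  calc 1 / (8 * u) = 1 / (4 * u) * (1 / 2) := by field_simp; norm_num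
    _ ≤ (J + 1) * (1 / 2) := by gcongr
    _ = ∑ j ∈ Finset.range (J + 1), (1 / 2 : ℝ) := by simp
    _ ≤ ∑ j ∈ Finset.range (J + 1), ((1 - u) ^ j) ^ 2 := by
        refine Finset.sum_le_sum fun j hj => ?_
        have hj' : (j : ℝ) ≤ 1 / (4 * u) :=
          le_trans (by exact_mod_cast Nat.lt_succ_iff.1 (Finset.mem_range.1 hj)) hJu
        rw [le_div_iff₀ (by positivity)] at hj'
        have h1 := one_add_mul_le_pow (a := -u) (by linarith) (j * 2)
        rw [← pow_mul, sub_eq_add_neg]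
        push_cast at h1
        linarith
    _ ≤ _ := Finset.sum_le_sum_of_subset_of_nonneg
        (Finset.range_mono (by omega)) fun j _ _ => sq_nonneg _

/-- Small ball estimate for a Kac polynomial at the point `1 - u`, where `1 / u` is `n` up to a
logarithmic factor. -/
lemma measureReal_abs_eval_kacPoly_le {Ω : Type*} [MeasurableSpace Ω] {μ : Measure Ω}
    [IsProbabilityMeasure μ] {ξ : ℕ → Ω → ℝ} (hξ : ∀ j, Measurable (ξ j)) (hind : iIndepFun ξ μ)
    {s₀ : ℝ} (hs₀ : 0 < s₀)
    (h : ∀ j s, |s| ≤ s₀ → ‖charFun (μ.map (ξ j)) s‖ ≤ Real.exp (-s ^ 2 / 4))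
    {n : ℕ} {u η l : ℝ} (hl : 0 ≤ l) (hη : η ≤ 1 / 8) (hu0 : 0 < u) (hu1 : u ≤ 1)
    (hun : 1 / (4 * u) ≤ n) (hul : Real.exp ((1 - η) * l) ≤ 1 / (8 * u)) :
    μ.real {ω | |(kacPoly (fun j => ξ j ω) n).eval (1 - u)| ≤ 2 * Real.exp ((1 / 2 - η) * l)} ≤
      (8 + 2 / s₀ ^ 2) * Real.exp (-(η / 2) * l) := by
  have he : ∀ ω, (kacPoly (fun j => ξ j ω) n).eval (1 - u) =
      ∑ j ∈ Finset.range (n + 1), (1 - u) ^ j * ξ j ω := by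
    intro ω
    simp only [kacPoly, eval_finsetSum, eval_mul, eval_C, eval_pow, eval_X]
    exact Finset.sum_congr rfl fun j _ => mul_comm _ _
  simp_rw [he]
  refine (measureReal_abs_sum_le hξ hind hs₀ h (w := fun j => (1 - u) ^ j) (fun j => ?_)
    (Real.exp_pos ((1 - η) * l)) (hul.trans (one_div_le_sum_range_sq_pow hu0 hu1 hun))
    (by positivity)).trans ?_
  · rw [abs_of_nonneg (pow_nonneg (by linarith) j)]
    exact pow_le_one₀ (by linarith) (by linarith)
  have h1 : 2 * Real.exp ((1 / 2 - η) * l) / Real.sqrt (Real.exp ((1 - η) * l) / 2) ≤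
      4 * Real.exp (-(η / 2) * l) := by
    rw [div_le_iff₀ (by positivity)]
    have h2 : Real.exp ((1 - η) * l / 2) / 2 ≤ Real.sqrt (Real.exp ((1 - η) * l) / 2) := by
      refine Real.le_sqrt_of_sq_le ?_
      rw [div_pow, ← Real.exp_nat_mul]
      have h3 : ((2 : ℕ) : ℝ) * ((1 - η) * l / 2) = (1 - η) * l := by push_cast; ring
      rw [h3]
      have := Real.exp_pos ((1 - η) * l)
      linarith
    calc 2 * Real.exp ((1 / 2 - η) * l)
        = 4 * Real.exp (-(η / 2) * l) * (Real.exp ((1 - η) * l / 2) / 2) := by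
          have : Real.exp ((1 / 2 - η) * l) =
              Real.exp (-(η / 2) * l) * Real.exp ((1 - η) * l / 2) := by
            rw [← Real.exp_add]; congr 1; ring
          rw [this]; ring
      _ ≤ _ := by gcongr
  have h2 : 1 / (2 * Real.exp ((1 / 2 - η) * l) * s₀) ^ 2 ≤
      1 / s₀ ^ 2 * Real.exp (-(η / 2) * l) := by
    have h3 : (2 * Real.exp ((1 / 2 - η) * l) * s₀) ^ 2 =
        4 * s₀ ^ 2 * Real.exp ((1 - 2 * η) * l) := by
      rw [mul_pow, mul_pow, ← Real.exp_nat_mul]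
      have : ((2 : ℕ) : ℝ) * ((1 / 2 - η) * l) = (1 - 2 * η) * l := by push_cast; ring
      rw [this]; ring
    rw [h3, neg_mul, Real.exp_neg, one_div_mul_eq_div, ← one_div, div_div]
    refine one_div_le_one_div_of_le (by positivity) ?_
    have h4 : Real.exp (η / 2 * l) ≤ Real.exp ((1 - 2 * η) * l) := by
      rw [Real.exp_le_exp]
      gcongr
      linarith
    have h5 : 0 < s₀ ^ 2 := by positivity
    have h6 := Real.exp_pos (η / 2 * l)
    nlinarith
  have h3 : 2 / s₀ ^ 2 = 2 * (1 / s₀ ^ 2) := by ring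
  rw [h3]
  linarith

/-- The asymptotic comparisons that hold for all large `n`. -/
lemma eventually_log_bounds {η δ : ℝ} (hη : 0 < η) (hδ : 0 < δ) (A B : ℝ) :
    ∀ᶠ n : ℕ in Filter.atTop, 2 ≤ n ∧ A * (Real.log n / n) ≤ 1 ∧
      1 + B * Real.log n ≤ Real.exp (η * Real.log n) ∧ 2 ≤ Real.exp (δ * Real.log n) ∧
      1 ≤ 4 * δ * Real.log n := by
  have hlog : Filter.Tendsto (fun n : ℕ => Real.log n) Filter.atTop Filter.atTop :=
    Real.tendsto_log_atTop.comp tendsto_natCast_atTop_atTop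
  have h1 : Filter.Tendsto (fun n : ℕ => A * (Real.log n / n)) Filter.atTop (nhds 0) := by
    have := (Real.isLittleO_log_id_atTop.tendsto_div_nhds_zero.comp
      (tendsto_natCast_atTop_atTop (R := ℝ))).const_mul A
    simpa [Function.comp_def] using this
  have h2 : ∀ᶠ l : ℝ in Filter.atTop, 1 + B * l ≤ Real.exp (η * l) := by
    have h3 : (fun l : ℝ => 1 + B * l) =o[Filter.atTop] fun l => Real.exp (η * l) := by
      refine Asymptotics.IsLittleO.add ?_ (Asymptotics.IsLittleO.const_mul_left ?_ B)
      · simpa using isLittleO_pow_exp_pos_mul_atTop 0 hη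
      · simpa using isLittleO_pow_exp_pos_mul_atTop 1 hη
    filter_upwards [h3.bound one_pos] with l hl
    rw [one_mul, Real.norm_eq_abs, Real.norm_eq_abs, abs_of_pos (Real.exp_pos _)] at hl
    exact (le_abs_self _).trans hl
  have h3 : Filter.Tendsto (fun n : ℕ => δ * Real.log n) Filter.atTop Filter.atTop :=
    hlog.const_mul_atTop hδ
  filter_upwards [Filter.eventually_ge_atTop 2, h1.eventually_le_const one_pos, hlog.eventually h2,
    h3.eventually_ge_atTop 1] with n hn h4 h5 h6
  refine ⟨hn, h4, h5, ?_, by linarith⟩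
  linarith [Real.add_one_le_exp (δ * Real.log n)]

/-! ### The tail bound for the maximal root count -/

theorem lemma5p1 (ε c C : ℝ) (hε : 0 < ε) (hc : 1 < c) (hC : 0 < C) :
    ∃ c' : ℝ, 0 < c' ∧
      ∀ (ε₀ M : ℝ), 0 < ε₀ →
        ∃ K : ℝ, 0 < K ∧
          ∀ (Ω : Type*) [MeasurableSpace Ω] (μ : Measure Ω) [IsProbabilityMeasure μ]
            (ξ : ℕ → Ω → ℝ),
            (∀ j, Measurable (ξ j)) →
            iIndepFun ξ μ →
            (∀ j, ∫ ω, ξ j ω ∂μ = 0) →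
            (∀ j, variance (ξ j) μ = 1) →
            (∀ j, ∫⁻ ω, ENNReal.ofReal (|ξ j ω| ^ (2 + ε₀)) ∂μ ≤ ENNReal.ofReal M) →
            ∀ n : ℕ, 1 ≤ n →
              μ.real {ω | ENNReal.ofReal (ε * Real.log n) <
                  (maxRootCount (fun j => ξ j ω) n c
                    (Set.Icc (1 - C * Real.log n / n) 1) : ℝ≥0∞)} ≤
                K * (n : ℝ) ^ (-c') := by
  -- The root count will be at most `(6 η L + 8 δ c) log n`; `δ` is chosen first, then the number
  -- `L` of test points, and `η` last.
  set δ : ℝ := ε / (16 * c) with hδdef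
  have hδ : 0 < δ := by positivity
  set L : ℕ := ⌈C / δ⌉₊ + 1 with hLdef
  have hL : C / δ + 1 ≤ L := by
    rw [hLdef]; push_cast; linarith [Nat.le_ceil (C / δ)]
  set η : ℝ := min (ε / (12 * L)) (min (δ / 4) (1 / 8))
  have hη : 0 < η := by
    refine lt_min (by positivity) (lt_min (by positivity) (by norm_num))
  have hη1 : η ≤ ε / (12 * L) := min_le_left _ _
  have hη2 : η ≤ δ / 4 := (min_le_right _ _).trans (min_le_left _ _)
  have hη3 : η ≤ 1 / 8 := (min_le_right _ _).trans (min_le_right _ _)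
  have hfinal : 6 * η * L + 8 * δ * c ≤ ε := by
    rw [le_div_iff₀ (by positivity)] at hη1
    have : δ * (16 * c) = ε := by rw [hδdef]; field_simp
    linarith
  refine ⟨η / 2, by positivity, fun ε₀ M hε₀ => ?_⟩
  obtain ⟨s₀, hs₀, hφ⟩ := exists_norm_charFun_map_le ε₀ M hε₀
  obtain ⟨n₀, hn₀⟩ := Filter.eventually_atTop.1 (eventually_log_bounds hη (half_pos hδ)
    (L * δ) ((L + 3) * δ * c + 8 * L * δ))
  refine ⟨2 * c + L * (8 + 2 / s₀ ^ 2) + (n₀ : ℝ) ^ (η / 2), by positivity, ?_⟩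
  intro Ω _ μ _ ξ hξ hind hmean hvar hmom n hn1
  have hn0 : (0 : ℝ) < n := by exact_mod_cast hn1
  have hpow : (n : ℝ) ^ (-(η / 2)) = Real.exp (-(η / 2) * Real.log n) := by
    rw [Real.rpow_def_of_pos hn0, mul_comm]
  rcases lt_or_ge n n₀ with hlt | hge
  · refine measureReal_le_one.trans ?_
    have h1 : 1 ≤ (n₀ : ℝ) ^ (η / 2) * (n : ℝ) ^ (-(η / 2)) := by
      rw [Real.rpow_neg hn0.le, ← div_eq_mul_inv, one_le_div (by positivity)]
      gcongr
    refine h1.trans ?_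
    gcongr
    have : 0 ≤ 2 * c + L * (8 + 2 / s₀ ^ 2) := by positivity
    linarith
  obtain ⟨hn2, hLδ, hη4, h2, h1l⟩ := hn₀ n hge
  have hl : 0 < Real.log n := Real.log_pos (by exact_mod_cast hn2)
  set l := Real.log n
  have hexpl : Real.exp l = n := Real.exp_log hn0
  set T := Real.exp ((1 / 2 + η) * l) with hT
  set bad₁ : Set Ω := {ω | ∃ j ≤ ⌊c * n⌋₊, T ≤ |∑ i ∈ Finset.range (j + 1), ξ i ω|}
  set bad₂ : ℕ → Set Ω := fun k => {ω | |(kacPoly (fun j => ξ j ω) n).eval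
    (1 - k * δ * (l / n))| ≤ 2 * Real.exp ((1 / 2 - η) * l)}
  have hsub : {ω | ENNReal.ofReal (ε * l) < (maxRootCount (fun j => ξ j ω) n c
      (Set.Icc (1 - C * l / n) 1) : ℝ≥0∞)} ⊆ bad₁ ∪ ⋃ k ∈ Finset.Icc 1 L, bad₂ k := by
    intro ω hω
    by_contra hgood
    simp only [bad₁, bad₂, Set.mem_union, Set.mem_iUnion, Set.mem_ofPred_eq, not_or, not_exists,
      not_and, not_le] at hgood hω
    obtain ⟨hg1, hg2⟩ := hgood
    refine absurd hω (not_lt.2 ?_)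
    have hmax : maxRootCount (fun j => ξ j ω) n c (Set.Icc (1 - C * l / n) 1) ≤
        (⌊ε * l⌋₊ : ℕ∞) := by
      refine Finset.sup_le fun m hm => ?_
      rw [Finset.mem_Icc] at hm
      have hmc : (m : ℝ) ≤ c * n := (Nat.le_floor_iff (by positivity)).1 hm.2
      have hη5 : 1 + (L + 3) * δ * c * l ≤ Real.exp (η * l) := by
        have h3 : 0 ≤ 8 * L * δ * l := by positivity
        linarith
      have hδη : 2 ≤ Real.exp ((δ - 2 * η) * l) := by
        refine h2.trans (Real.exp_le_exp.2 (mul_le_mul_of_nonneg_right ?_ hl.le))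
        linarith
      obtain ⟨hp, hcard⟩ := card_roots_kacPoly_le (a := fun j => ξ j ω) hn2 hm.1 hmc hC hδ hL
        hLδ hη5 hδη (fun j hj => (hg1 j (hj.trans hm.2)).le) (fun k hk => (hg2 k hk).le)
      rw [rootCount, if_neg hp, Nat.cast_le]
      refine Nat.le_floor (le_trans (le_of_eq ?_) (hcard.trans ?_))
      · congr!
      · gcongr
    calc (maxRootCount (fun j => ξ j ω) n c (Set.Icc (1 - C * l / n) 1) : ℝ≥0∞)
        ≤ ((⌊ε * l⌋₊ : ℕ∞) : ℝ≥0∞) := ENat.toENNReal_mono hmax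
      _ = ENNReal.ofReal (⌊ε * l⌋₊ : ℝ) := by simp
      _ ≤ _ := ENNReal.ofReal_le_ofReal (Nat.floor_le (by positivity))
  have hbad₁ : μ.real bad₁ ≤ 2 * c * Real.exp (-(η / 2) * l) := by
    refine (measureReal_exists_le_abs_sum_le hξ hind hmean hvar _ (Real.exp_pos _)).trans ?_
    rw [div_le_iff₀ (by positivity)]
    have h3 : Real.exp (-(η / 2) * l) * T ^ 2 = n * Real.exp (3 / 2 * η * l) := by
      rw [hT, ← Real.exp_nat_mul, ← Real.exp_add, ← hexpl, ← Real.exp_add]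
      congr 1; push_cast; ring
    rw [mul_assoc, h3]
    have h4 : (⌊c * n⌋₊ : ℝ) ≤ c * n := Nat.floor_le (by positivity)
    have h5 : 1 ≤ Real.exp (3 / 2 * η * l) := Real.one_le_exp (by positivity)
    have h6 : (1 : ℝ) ≤ n := by exact_mod_cast hn1
    have h7 : 1 ≤ c * n := by nlinarith
    have h8 : c * n ≤ c * n * Real.exp (3 / 2 * η * l) := le_mul_of_one_le_right (by positivity) h5
    linarith
  have hbad₂ : ∀ k ∈ Finset.Icc 1 L, μ.real (bad₂ k) ≤
      (8 + 2 / s₀ ^ 2) * Real.exp (-(η / 2) * l) := by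
    intro k hk
    have hk1 : (1 : ℝ) ≤ k := by exact_mod_cast (Finset.mem_Icc.1 hk).1
    have hkL : (k : ℝ) ≤ L := by exact_mod_cast (Finset.mem_Icc.1 hk).2
    have hk0 : (0 : ℝ) < k := by linarith
    have hu0 : 0 < k * δ * (l / n) := by positivity
    refine measureReal_abs_eval_kacPoly_le hξ hind hs₀
      (fun j => hφ Ω μ (ξ j) (hξ j) (hmean j) (hvar j) (hmom j)) hl.le hη3 hu0 ?_ ?_ ?_
    · refine le_trans ?_ hLδ
      gcongr
    · rw [div_le_iff₀ (by positivity)]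
      have h3 : n * (4 * (k * δ * (l / n))) = k * (4 * δ * l) := by field_simp
      rw [h3]
      have : 0 < δ * l := by positivity
      nlinarith
    · rw [le_div_iff₀ (by positivity)]
      have h3 : Real.exp ((1 - η) * l) = n * Real.exp (-(η * l)) := by
        rw [← hexpl, ← Real.exp_add]; congr 1; ring
      have h4 : 8 * k * δ * l ≤ Real.exp (η * l) := by
        refine le_trans ?_ hη4
        have h5 : 8 * k * δ * l ≤ 8 * L * δ * l := by gcongr
        have h6 : 0 ≤ (L + 3) * δ * c * l := by positivity
        linarith
      have h5 : Real.exp ((1 - η) * l) * (8 * (k * δ * (l / n))) =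
          Real.exp (-(η * l)) * (8 * k * δ * l) := by
        rw [h3]; field_simp
      rw [h5]
      calc _ ≤ Real.exp (-(η * l)) * Real.exp (η * l) := by gcongr
        _ = 1 := by rw [← Real.exp_add]; simp
  calc _ ≤ μ.real (bad₁ ∪ ⋃ k ∈ Finset.Icc 1 L, bad₂ k) := measureReal_mono hsub
    _ ≤ μ.real bad₁ + ∑ k ∈ Finset.Icc 1 L, μ.real (bad₂ k) :=
        (measureReal_union_le _ _).trans
          (add_le_add le_rfl (measureReal_biUnion_finset_le _ _))
    _ ≤ 2 * c * Real.exp (-(η / 2) * l) +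
        ∑ k ∈ Finset.Icc 1 L, (8 + 2 / s₀ ^ 2) * Real.exp (-(η / 2) * l) :=
        add_le_add hbad₁ (Finset.sum_le_sum hbad₂)
    _ = (2 * c + L * (8 + 2 / s₀ ^ 2)) * Real.exp (-(η / 2) * l) := by
        rw [Finset.sum_const, Nat.card_Icc, nsmul_eq_mul, Nat.add_sub_cancel]; ring
    _ ≤ _ := by
        rw [hpow]
        have : 0 ≤ (n₀ : ℝ) ^ (η / 2) := by positivity
        refine mul_le_mul_of_nonneg_right ?_ (Real.exp_pos _).le
        linarith
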